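/- Let $\alpha,\beta,\gamma\in\mathbb{C}$, let $q(x,\xi)=\alpha x^2+2\beta x\xi+\gamma\xi^2$ for $(x,\xi)\in\mathbb{R}^2$, and let $$Q=\alpha x^2-i\beta\Bigl(x\frac{d}{dx}+\frac{d}{dx}x\Bigr)-\gamma\frac{d^2}{dx^2},\qquad \operatorname{Dom}Q=\{u\in L^2(\mathbb{R}) : Qu\in L^2(\mathbb{R})\}$$ (with $Qu$ taken in the sense of distributions) be its Weyl quantization. Assume that $q$ is elliptic: $q(x,\xi)=0$ only for $(x,\xi)=(0,0)$, and $q(\mathbb{R}^2)\neq\mathbb{C}$. Then the fundamental matrix $$F=\begin{pmatrix}\beta&\gamma\\-\alpha&-\beta\end{pmatrix}$$ has an eigensystem of the following form: there are $\lambda,a_+,a_-\in\mathbb{C}$ such that $\sigma(F)=\{\lambda,-\lambda\}$, $\operatorname{Ker}(F\mp\lambda)=\operatorname{span}\{(1,a_\pm)\}$ and $\pm\operatorname{Im}a_\pm>0$. For any such $\lambda,a_+,a_-$ there is a (necessarily unique) $\theta\in[0,\pi/2)$ with $$\sin\theta=\left|\frac{a_+-\overline{a_-}}{a_+-a_-}\right|,$$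 and, for this $\theta$, the operator $Q$, as an unbounded operator on $L^2(\mathbb{R})$, is unitarily equivalent to $$-i\lambda\left(-e^{-i\theta}\frac{d^2}{dx^2}+e^{i\theta}x^2\right),$$ where the operator in parentheses is likewise taken on its maximal domain in $L^2(\mathbb{R})$. -/

import Mathlib

open MeasureTheory
open scoped SchwartzMap

noncomputable section

namespace QuadraticOperator

/-- The complex Hilbert space `L²(ℝ)` with respect to Lebesgue measure. -/
abbrev L2 : Type := Lp ℂ 2 (volume : Measure ℝ)

/-- Multiplication by the variable `x`, acting on tempered distributions on `ℝ`. -/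
def X : 𝓢'(ℝ, ℂ) →L[ℂ] 𝓢'(ℝ, ℂ) := TemperedDistribution.smulLeftCLM ℂ (fun x : ℝ => (x : ℂ))

/-- The distributional derivative `d/dx`, acting on tempered distributions on `ℝ`. -/
def D : 𝓢'(ℝ, ℂ) →L[ℂ] 𝓢'(ℝ, ℂ) := TemperedDistribution.derivCLM ℂ

/-- The canonical embedding of `L²(ℝ)` into the tempered distributions. -/
def embed : L2 →ₗ[ℂ] 𝓢'(ℝ, ℂ) :=
  (Lp.toTemperedDistributionCLM ℂ (volume : Measure ℝ) 2).toLinearMap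

theorem embed_injective : Function.Injective embed :=
  LinearMap.ker_eq_bot.mp Lp.ker_toTemperedDistributionCLM_eq_bot

/-- The maximal realization on `L²(ℝ)` of an operator `A` on tempered distributions: the unbounded
operator `u ↦ A u` with domain `{u ∈ L²(ℝ) | A u ∈ L²(ℝ)}`. -/
def maximal (A : 𝓢'(ℝ, ℂ) →L[ℂ] 𝓢'(ℝ, ℂ)) : L2 →ₗ.[ℂ] L2 where
  domain := (LinearMap.range embed).comap (A.toLinearMap ∘ₗ embed)
  toFun := (LinearEquiv.ofInjective embed embed_injective).symm.toLinearMap ∘ₗ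
    (A.toLinearMap ∘ₗ embed).restrict (fun _ hu => hu)

/-- The quadratic symbol `q(x, ξ) = α x² + 2 β x ξ + γ ξ²`. -/
def symbol (α β γ : ℂ) (p : ℝ × ℝ) : ℂ :=
  α * (p.1 : ℂ) ^ 2 + 2 * β * (p.1 : ℂ) * (p.2 : ℂ) + γ * (p.2 : ℂ) ^ 2

/-- Ellipticity: the symbol vanishes only at the origin and does not take every complex value. -/
def IsElliptic (q : ℝ × ℝ → ℂ) : Prop :=
  (∀ p : ℝ × ℝ, q p = 0 → p = (0, 0)) ∧ Set.range q ≠ Set.univ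

/-- The Weyl quantization of `α x² + 2 β x ξ + γ ξ²`, that is,
`α x² - i β (x d/dx + d/dx x) - γ d²/dx²` on its maximal domain in `L²(ℝ)`. -/
def weyl (α β γ : ℂ) : L2 →ₗ.[ℂ] L2 :=
  maximal (α • (X ∘L X) - (Complex.I * β) • (X ∘L D + D ∘L X) - γ • (D ∘L D))

/-- The rotated harmonic oscillator `-e^{-iθ} d²/dx² + e^{iθ} x²` on its maximal domain. -/
def rotatedOscillator (θ : ℝ) : L2 →ₗ.[ℂ] L2 :=
  maximal (-(Complex.exp (-(Complex.I * θ)) • (D ∘L D)) + Complex.exp (Complex.I * θ) • (X ∘L X))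

/-- The fundamental matrix of the quadratic symbol `α x² + 2 β x ξ + γ ξ²`. -/
def fundamentalMatrix (α β γ : ℂ) : Matrix (Fin 2) (Fin 2) ℂ :=
  !![β, γ; -α, -β]

/-- `F` has spectrum `{lam, -lam}`, with `Ker (F - lam)` spanned by `(1, aPlus)`, `Im aPlus > 0`,
and `Ker (F + lam)` spanned by `(1, aMinus)`, `Im aMinus < 0`. -/
structure IsEigensystem (F : Matrix (Fin 2) (Fin 2) ℂ) (lam aPlus aMinus : ℂ) : Prop where
  spectrum_eq : spectrum ℂ F = {lam, -lam}
  ker_plus : LinearMap.ker (Matrix.toLin' (F - lam • (1 : Matrix (Fin 2) (Fin 2) ℂ))) =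
    Submodule.span ℂ {![1, aPlus]}
  ker_minus : LinearMap.ker (Matrix.toLin' (F + lam • (1 : Matrix (Fin 2) (Fin 2) ℂ))) =
    Submodule.span ℂ {![1, aMinus]}
  im_plus : 0 < aPlus.im
  im_minus : aMinus.im < 0

/-- Unitary equivalence of unbounded operators on `L²(ℝ)`: some unitary `U` maps the domain of `A`
onto the domain of `B` and satisfies `B U u = U A u` there; equivalently, `U × U` maps the graph of
`A` onto the graph of `B`. -/
def UnitarilyEquivalent (A B : L2 →ₗ.[ℂ] L2) : Prop :=
  ∃ U : L2 ≃ₗᵢ[ℂ] L2, ∀ u v : L2, (u, v) ∈ A.graph ↔ (U u, U v) ∈ B.graph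

end QuadraticOperator

end

namespace QuadraticOperator

open scoped ContDiff FourierTransform LineDeriv

/-! The symbol factors as `γ (ξ - a₊ x)(ξ - a₋ x)`, so it is determined by `λ` and the slopes `a₊,
a₋`. A real symplectic substitution preserves `λ` and moves both slopes by one real Möbius map,
while unitaries implement it on the operator. In the upper half-plane the pair `a₊`, `conj a₋` has a
single invariant under such maps, its pseudo-hyperbolic distance, which is the prescribed `sin θ`.
Moving the pair to `z`, `-conj z` with `|z| = 1` and `Re z ≤ 0` forces `z = i e^{iθ}`, the slope of
the rotated oscillator.

Only two unitaries are needed: chirps (`weyl_shear`) and the Fourier transform (`weyl_fourier`).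
Conjugating one by the other gives the opposite shears, and three shears give the inversions.
`exists_slopeEquiv_neg` performs the normalization.

For existence of the eigensystem, ellipticity makes the slopes nonreal. If both lay in one
half-plane, the argument of `q / γ` would sweep a full turn and `q` would be surjective. -/

/-! ### Maximal realizations and unitary equivalence -/

/-- Reduces every question about domains to an identity between tempered distributions. -/
theorem mem_graph_maximal {A : 𝓢'(ℝ, ℂ) →L[ℂ] 𝓢'(ℝ, ℂ)} {u v : L2} :
    (u, v) ∈ (maximal A).graph ↔ A (embed u) = embed v := by
  have key : ∀ y : (maximal A).domain, embed (maximal A y) = A (embed y) := fun y =>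
    congrArg Subtype.val ((LinearEquiv.ofInjective embed embed_injective).apply_symm_apply _)
  rw [LinearPMap.mem_graph_iff]
  constructor
  · rintro ⟨y, rfl, rfl⟩
    exact (key y).symm
  · intro h
    refine ⟨⟨u, ⟨v, h.symm⟩⟩, rfl, embed_injective ?_⟩
    rw [key]
    exact h

/-- For `c = 0` this fails in general: the left side keeps the maximal domain of `A`, while `maximal
0` is defined everywhere. -/
theorem smul_maximal {c : ℂ} (hc : c ≠ 0) (A : 𝓢'(ℝ, ℂ) →L[ℂ] 𝓢'(ℝ, ℂ)) :
    c • maximal A = maximal (c • A) := by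
  refine LinearPMap.eq_of_eq_graph ?_
  ext ⟨u, v⟩
  rw [LinearPMap.smul_graph, mem_graph_maximal, Submodule.mem_map]
  constructor
  · rintro ⟨⟨u', w⟩, h, h'⟩
    simp only [LinearMap.prodMap_apply, LinearMap.id_coe, id_eq, LinearMap.smul_apply,
      Prod.mk.injEq] at h'
    obtain ⟨rfl, rfl⟩ := h'
    rw [mem_graph_maximal] at h
    simp [h]
  · intro h
    refine ⟨(u, c⁻¹ • v), ?_, by simp [smul_smul, hc]⟩
    rw [mem_graph_maximal, map_smul, ← h]
    simp [smul_smul, hc]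

theorem UnitarilyEquivalent.symm {A B : L2 →ₗ.[ℂ] L2} (h : UnitarilyEquivalent A B) :
    UnitarilyEquivalent B A := by
  obtain ⟨U, hU⟩ := h
  exact ⟨U.symm, fun u v => by rw [hU]; simp⟩

theorem UnitarilyEquivalent.trans {A B C : L2 →ₗ.[ℂ] L2} (h : UnitarilyEquivalent A B)
    (h' : UnitarilyEquivalent B C) : UnitarilyEquivalent A C := by
  obtain ⟨U, hU⟩ := h
  obtain ⟨V, hV⟩ := h'
  exact ⟨U.trans V, fun u v => by rw [hU, hV]; rfl⟩

/-- A unitary operator on `L²(ℝ)` that extends to an injective map of tempered distributions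
intertwining `A` and `B` makes the maximal realizations unitarily equivalent. -/
theorem unitarilyEquivalent_maximal {A B : 𝓢'(ℝ, ℂ) →L[ℂ] 𝓢'(ℝ, ℂ)} (U : L2 ≃ₗᵢ[ℂ] L2)
    (V : 𝓢'(ℝ, ℂ) → 𝓢'(ℝ, ℂ)) (hV : Function.Injective V)
    (hUV : ∀ u, embed (U u) = V (embed u)) (hAB : ∀ f, V (A f) = B (V f)) :
    UnitarilyEquivalent (maximal A) (maximal B) := by
  refine ⟨U, fun u v => ?_⟩
  rw [mem_graph_maximal, mem_graph_maximal, hUV, hUV, ← hAB, hV.eq_iff]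

/-! ### Chirps and the shears `ξ ↦ ξ + c x` -/

theorem hasTemperateGrowth_cexp_I_mul :
    Function.HasTemperateGrowth (fun t : ℝ => Complex.exp (Complex.I * t)) := by
  have hd : ∀ n : ℕ, iteratedDeriv n (fun t : ℝ => Complex.exp (Complex.I * t)) =
      fun t : ℝ => Complex.I ^ n * Complex.exp (Complex.I * t) := by
    intro n
    induction n with
    | zero => simp
    | succ n ih =>
      rw [iteratedDeriv_succ, ih]
      ext t
      have h : HasDerivAt (fun t : ℝ => Complex.exp (Complex.I * t))
          (Complex.exp (Complex.I * t) * (Complex.I * 1)) t :=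
        ((Complex.ofRealCLM.hasDerivAt (x := t)).const_mul Complex.I).cexp
      rw [(h.const_mul _).deriv]
      ring
  refine ⟨(contDiff_const.mul Complex.ofRealCLM.contDiff).cexp, fun n => ⟨0, 1, fun t => ?_⟩⟩
  rw [norm_iteratedFDeriv_eq_norm_iteratedDeriv, hd]
  simp [Complex.norm_exp]

/-- The chirp `x ↦ exp (i c x² / 2)`. -/
noncomputable def chirp (c : ℝ) (x : ℝ) : ℂ := Complex.exp (Complex.I * ((c / 2 * x ^ 2 : ℝ) : ℂ))

theorem chirp_mul_chirp_neg (c : ℝ) : chirp c * chirp (-c) = fun _ => 1 := by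
  ext x
  simp only [chirp, Pi.mul_apply, ← Complex.exp_add]
  rw [← Complex.exp_zero]
  congr 1
  push_cast
  ring

theorem norm_chirp (c x : ℝ) : ‖chirp c x‖ = 1 := by
  rw [chirp, mul_comm, Complex.norm_exp_ofReal_mul_I]

theorem hasTemperateGrowth_chirp (c : ℝ) : (chirp c).HasTemperateGrowth := by
  have h : Function.HasTemperateGrowth (fun x : ℝ => c / 2 * x ^ 2) :=
    (Function.HasTemperateGrowth.const _).mul (Function.HasTemperateGrowth.id'.pow 2)
  exact hasTemperateGrowth_cexp_I_mul.comp h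

theorem hasDerivAt_chirp (c x : ℝ) :
    HasDerivAt (chirp c) (Complex.I * c * x * chirp c x) x := by
  have h : HasDerivAt (fun x : ℝ => c / 2 * x ^ 2) (c / 2 * (2 * x)) x := by
    simpa using (hasDerivAt_pow 2 x).const_mul (c / 2)
  convert (h.ofReal_comp.const_mul Complex.I).cexp using 1
  · rfl
  · rw [chirp]
    push_cast
    ring

theorem memLp_chirp (c : ℝ) : MemLp (chirp c) ⊤ (volume : Measure ℝ) := by
  refine memLp_top_of_bound (hasTemperateGrowth_chirp c).1.continuous.aestronglyMeasurable 1 ?_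
  simp [norm_chirp]

theorem smulLeftCLM_chirp_neg (c : ℝ) (f : 𝓢'(ℝ, ℂ)) :
    TemperedDistribution.smulLeftCLM ℂ (chirp (-c))
      (TemperedDistribution.smulLeftCLM ℂ (chirp c) f) = f := by
  rw [TemperedDistribution.smulLeftCLM_smulLeftCLM_apply (hasTemperateGrowth_chirp _)
    (hasTemperateGrowth_chirp _), chirp_mul_chirp_neg]
  simp

/-- Multiplication by a chirp on `L²(ℝ)`. -/
noncomputable def chirpMul (c : ℝ) : L2 →ₗ[ℂ] L2 where
  toFun u := (memLp_chirp c).toLp • u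
  map_add' u v := Lp.add_smul _ _ _
  map_smul' a u := by
    apply embed_injective
    change Lp.toTemperedDistribution _ = Lp.toTemperedDistributionCLM ℂ volume 2 (_ • _)
    rw [map_smul, Lp.toTemperedDistribution_smul_eq (hasTemperateGrowth_chirp c)]
    change TemperedDistribution.smulLeftCLM ℂ (chirp c) (Lp.toTemperedDistributionCLM ℂ volume 2 _)
      = a • Lp.toTemperedDistribution _
    rw [map_smul, map_smul, Lp.toTemperedDistribution_smul_eq (hasTemperateGrowth_chirp c)]
    rfl

theorem embed_chirpMul (c : ℝ) (u : L2) :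
    embed (chirpMul c u) = TemperedDistribution.smulLeftCLM ℂ (chirp c) (embed u) :=
  Lp.toTemperedDistribution_smul_eq (hasTemperateGrowth_chirp c) (memLp_chirp c) u

theorem chirpMul_neg_chirpMul (c : ℝ) (u : L2) : chirpMul (-c) (chirpMul c u) = u := by
  apply embed_injective
  rw [embed_chirpMul, embed_chirpMul, smulLeftCLM_chirp_neg]

theorem norm_chirpMul (c : ℝ) (u : L2) : ‖chirpMul c u‖ = ‖u‖ := by
  rw [Lp.norm_def, Lp.norm_def]
  congr 1
  apply eLpNorm_congr_norm_ae
  filter_upwards [Lp.coeFn_lpSMul (r := 2) (memLp_chirp c).toLp u, (memLp_chirp c).coeFn_toLp]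
    with x hx hx'
  change ‖((memLp_chirp c).toLp • u : L2) x‖ = _
  rw [hx, Pi.smul_apply', hx', norm_smul, norm_chirp, one_mul]

/-- Multiplication by a chirp as a unitary operator on `L²(ℝ)`. -/
noncomputable def chirpUnitary (c : ℝ) : L2 ≃ₗᵢ[ℂ] L2 where
  toLinearEquiv := LinearEquiv.ofLinearMap (chirpMul c) (chirpMul (-c))
    (LinearMap.ext fun u => by simpa using chirpMul_neg_chirpMul (-c) u)
    (LinearMap.ext fun u => chirpMul_neg_chirpMul c u)
  norm_map' := norm_chirpMul c

theorem hasTemperateGrowth_ofReal : Function.HasTemperateGrowth (fun x : ℝ => (x : ℂ)) :=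
  Function.Complex.hasTemperateGrowth_ofReal

theorem X_chirp (c : ℝ) (f : 𝓢'(ℝ, ℂ)) :
    X (TemperedDistribution.smulLeftCLM ℂ (chirp c) f) =
      TemperedDistribution.smulLeftCLM ℂ (chirp c) (X f) := by
  rw [X, TemperedDistribution.smulLeftCLM_smulLeftCLM_apply (hasTemperateGrowth_chirp _)
    hasTemperateGrowth_ofReal, TemperedDistribution.smulLeftCLM_smulLeftCLM_apply
    hasTemperateGrowth_ofReal (hasTemperateGrowth_chirp _), mul_comm]

theorem D_chirp (c : ℝ) (f : 𝓢'(ℝ, ℂ)) :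
    D (TemperedDistribution.smulLeftCLM ℂ (chirp c) f) =
      TemperedDistribution.smulLeftCLM ℂ (chirp c) (D f + (Complex.I * c) • X f) := by
  ext φ
  -- The transposed identity on test functions, which is the Leibniz rule for `chirp c * φ`.
  have hφ : -SchwartzMap.derivCLM ℂ ℂ (SchwartzMap.smulLeftCLM ℂ (chirp c) φ) =
      -SchwartzMap.smulLeftCLM ℂ (chirp c) (SchwartzMap.derivCLM ℂ ℂ φ) - (Complex.I * c) •
        SchwartzMap.smulLeftCLM ℂ (fun x : ℝ => (x : ℂ))
          (SchwartzMap.smulLeftCLM ℂ (chirp c) φ) := by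
    ext x
    have hd := (hasDerivAt_chirp c x).mul (φ.differentiableAt (x := x)).hasDerivAt
    have he : (⇑(SchwartzMap.smulLeftCLM ℂ (chirp c) φ) : ℝ → ℂ) = chirp c * ⇑φ := by
      ext y
      simp [SchwartzMap.smulLeftCLM_apply_apply (hasTemperateGrowth_chirp c)]
    simp only [_root_.neg_apply, _root_.sub_apply, _root_.smul_apply, SchwartzMap.derivCLM_apply,
      SchwartzMap.smulLeftCLM_apply_apply (hasTemperateGrowth_chirp c),
      SchwartzMap.smulLeftCLM_apply_apply hasTemperateGrowth_ofReal]
    rw [he, hd.deriv]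
    simp only [smul_eq_mul]
    ring
  simp [D, X, hφ]

/-- Multiplication by a chirp realizes the substitution `ξ ↦ ξ + c x`. -/
theorem weyl_shear (α β γ : ℂ) (c : ℝ) :
    UnitarilyEquivalent (weyl (α + 2 * β * c + γ * c ^ 2) (β + γ * c) γ) (weyl α β γ) := by
  refine unitarilyEquivalent_maximal (chirpUnitary c)
    (TemperedDistribution.smulLeftCLM ℂ (chirp c))
    (Function.LeftInverse.injective (smulLeftCLM_chirp_neg c)) (embed_chirpMul c) fun f => ?_
  simp only [_root_.sub_apply, _root_.add_apply,
    _root_.smul_apply, ContinuousLinearMap.comp_apply, X_chirp, D_chirp, map_add,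
    map_sub, map_smul]
  match_scalars <;> ring_nf
  simp only [Complex.I_sq]
  ring

/-! ### The Fourier transform, lower shears and rotations -/

theorem D_eq_lineDerivOp (f : 𝓢'(ℝ, ℂ)) : D f = ∂_{(1 : ℝ)} f := by
  ext φ
  change f (-SchwartzMap.derivCLM ℂ ℂ φ) = f (-∂_{(1 : ℝ)} φ)
  congr 2

theorem D_fourier (f : 𝓢'(ℝ, ℂ)) : 𝓕 (D f) = (2 * Real.pi * Complex.I) • X (𝓕 f) := by
  have h := TemperedDistribution.fourier_lineDerivOp_eq f (1 : ℝ)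
  simpa [X, D_eq_lineDerivOp] using h

theorem X_fourier (f : 𝓢'(ℝ, ℂ)) : 𝓕 (X f) = (Complex.I / (2 * Real.pi)) • D (𝓕 f) := by
  have h : D (𝓕 f) = -((2 * Real.pi * Complex.I) • 𝓕 (X f)) := by
    simpa [X, D_eq_lineDerivOp] using TemperedDistribution.lineDerivOp_fourier_eq f (1 : ℝ)
  have hI : Complex.I / (2 * Real.pi) * (2 * Real.pi * Complex.I) = -1 := by
    have := Real.pi_ne_zero
    field_simp
    simp
  rw [h, smul_neg, smul_smul, hI, neg_smul, one_smul, neg_neg]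

/-- The Fourier transform realizes the quarter turn of phase space, up to a dilation. -/
theorem weyl_fourier (α β γ : ℂ) :
    UnitarilyEquivalent (weyl α β γ)
      (weyl (4 * Real.pi ^ 2 * γ) (-β) (α / (4 * Real.pi ^ 2))) := by
  refine unitarilyEquivalent_maximal (Lp.fourierTransformₗᵢ ℝ ℂ) (fun f => 𝓕 f)
    (Function.LeftInverse.injective (g := fun f => 𝓕⁻ f)
      fun f => FourierTransform.fourierInv_fourier_eq f)
    (fun u => (Lp.fourier_toTemperedDistribution_eq u).symm) fun f => ?_
  have hpi : (Real.pi : ℂ) ≠ 0 := by exact_mod_cast Real.pi_ne_zero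
  have hs : ∀ f g : 𝓢'(ℝ, ℂ), 𝓕 (f - g) = 𝓕 f - 𝓕 g := fun f g =>
    map_sub (FourierTransform.fourierCLM ℂ 𝓢'(ℝ, ℂ)) f g
  simp only [_root_.sub_apply, _root_.add_apply,
    _root_.smul_apply, ContinuousLinearMap.comp_apply, hs,
    FourierTransform.fourier_add, FourierTransform.fourier_smul, D_fourier, X_fourier, map_smul]
  match_scalars <;> field_simp <;> ring_nf <;> simp only [Complex.I_sq] <;> ring

/-- The Fourier transform conjugates the shears along `ξ` into the shears `x ↦ x + c ξ`. Two Fourier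
transforms amount to a parity, which no quadratic form sees; the factor `4π²` in the shear parameter
compensates for the `2π` in the Fourier kernel. -/
theorem weyl_lower_shear (α β γ : ℂ) (c : ℝ) :
    UnitarilyEquivalent (weyl α β γ) (weyl α (β + α * c) (γ + 2 * β * c + α * c ^ 2)) := by
  have hpi : (Real.pi : ℂ) ≠ 0 := by exact_mod_cast Real.pi_ne_zero
  have h₁ := weyl_fourier α β γ
  have h₂ := (weyl_shear (4 * Real.pi ^ 2 * γ) (-β) (α / (4 * Real.pi ^ 2))
    (-(4 * Real.pi ^ 2) * c)).symm
  have h₃ := (h₁.trans h₂).trans (weyl_fourier _ _ _)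
  convert h₃ using 2
  all_goals
    push_cast
    field_simp
    try ring

/-- The phase-space rotation `(x, ξ) ↦ (-ξ / t, t x)`. -/
theorem weyl_rotate (α β γ : ℂ) {t : ℝ} (ht : t ≠ 0) :
    UnitarilyEquivalent (weyl α β γ) (weyl (t ^ 2 * γ) (-β) (α / t ^ 2)) := by
  have ht' : (t : ℂ) ≠ 0 := by exact_mod_cast ht
  -- The rotation is a product of three shears, with parameters `t`, `-1 / t`, `t`, so dilations
  -- need no unitary of their own.
  have h₁ := (weyl_shear α β γ t).symm
  have h₂ := h₁.trans (weyl_lower_shear _ _ _ (-1 / t))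
  have h₃ := h₂.trans (weyl_shear _ _ _ t).symm
  convert h₃ using 2
  all_goals
    push_cast
    field_simp
    try ring

/-! ### Möbius action on the slopes and normal form -/

/-- The quantization of the quadratic form whose fundamental matrix has eigenvectors `(1, z)` and
`(1, w)` for the eigenvalues `lam` and `-lam`. -/
noncomputable def weylOfEigen (lam z w : ℂ) : L2 →ₗ.[ℂ] L2 :=
  weyl (2 * lam * z * w / (z - w)) (-lam * (z + w) / (z - w)) (2 * lam / (z - w))

/-- Pairs of eigenvector slopes in opposite half-planes with the same invariant and with unitarily
equivalent quantizations. -/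
structure SlopeEquiv (z w z' w' : ℂ) : Prop where
  im_pos : 0 < z'.im
  im_neg : w'.im < 0
  invariant_eq : ‖(z' - (starRingEnd ℂ) w') / (z' - w')‖ = ‖(z - (starRingEnd ℂ) w) / (z - w)‖
  unitarilyEquivalent : ∀ lam : ℂ,
    UnitarilyEquivalent (weylOfEigen lam z w) (weylOfEigen lam z' w')

theorem SlopeEquiv.trans {z w z' w' z'' w'' : ℂ} (h : SlopeEquiv z w z' w')
    (h' : SlopeEquiv z' w' z'' w'') : SlopeEquiv z w z'' w'' :=
  ⟨h'.im_pos, h'.im_neg, h'.invariant_eq.trans h.invariant_eq,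
    fun lam => (h.unitarilyEquivalent lam).trans (h'.unitarilyEquivalent lam)⟩

theorem ne_of_im {z w : ℂ} (hz : 0 < z.im) (hw : w.im < 0) : z ≠ w := by
  rintro rfl
  linarith

/-- The substitution `ξ ↦ ξ + c x` turns the factor `ξ - z x` into `ξ - (z - c) x`. -/
theorem SlopeEquiv.shift {z w : ℂ} (hz : 0 < z.im) (hw : w.im < 0) (c : ℝ) :
    SlopeEquiv z w (z - c) (w - c) := by
  have hzw := sub_ne_zero.2 (ne_of_im hz hw)
  refine ⟨by simpa, by simpa, by simp, fun lam => ?_⟩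
  have h := (weyl_shear (2 * lam * z * w / (z - w)) (-lam * (z + w) / (z - w))
    (2 * lam / (z - w)) c).symm
  unfold weylOfEigen
  rw [sub_sub_sub_cancel_right]
  convert h using 2
  all_goals
    field_simp
    try ring

/-- The line `ξ = z x` pulls back under `(x, ξ) ↦ (-ξ / t, t x)` to the line of slope `-t² / z`. The
quotient in the invariant only acquires the unimodular factor `w / conj w`. -/
theorem SlopeEquiv.invert {z w : ℂ} (hz : 0 < z.im) (hw : w.im < 0) {t : ℝ} (ht : t ≠ 0) :
    SlopeEquiv z w (-(t ^ 2 / z)) (-(t ^ 2 / w)) := by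
  have ht' : (t : ℂ) ≠ 0 := by exact_mod_cast ht
  have hzw := sub_ne_zero.2 (ne_of_im hz hw)
  have hz0 : z ≠ 0 := by rintro rfl; simp at hz
  have hw0 : w ≠ 0 := by rintro rfl; simp at hw
  have hwc : (starRingEnd ℂ) w ≠ 0 := by simpa
  have ht2 : (0 : ℝ) < t ^ 2 := by positivity
  have him : ∀ a : ℂ, (-((t : ℂ) ^ 2 / a)).im = t ^ 2 * a.im / Complex.normSq a := by
    intro a
    rw [div_eq_mul_inv, ← Complex.ofReal_pow, Complex.neg_im, Complex.im_ofReal_mul, Complex.inv_im]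
    ring
  have hdiff : -((t : ℂ) ^ 2 / z) - -(t ^ 2 / w) = t ^ 2 * (z - w) / (z * w) := by
    field_simp
    ring
  refine ⟨?_, ?_, ?_, fun lam => ?_⟩
  · rw [him]
    exact div_pos (mul_pos ht2 hz) (Complex.normSq_pos.2 hz0)
  · rw [him]
    exact div_neg_of_neg_of_pos (mul_neg_of_pos_of_neg ht2 hw) (Complex.normSq_pos.2 hw0)
  · have : (-((t : ℂ) ^ 2 / z) - (starRingEnd ℂ) (-(t ^ 2 / w))) / (-(t ^ 2 / z) - -(t ^ 2 / w)) =
        (z - (starRingEnd ℂ) w) / (z - w) * (w / (starRingEnd ℂ) w) := by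
      rw [hdiff]
      simp only [map_neg, map_div₀, map_pow, Complex.conj_ofReal]
      field_simp
      ring
    rw [this, norm_mul, norm_div w, Complex.norm_conj, div_self (norm_ne_zero_iff.2 hw0), mul_one]
  · have h := weyl_rotate (2 * lam * z * w / (z - w)) (-lam * (z + w) / (z - w))
      (2 * lam / (z - w)) ht
    unfold weylOfEigen
    rw [hdiff]
    convert h using 2
    all_goals
      field_simp
      try ring

/-- Inversion at a suitable centre brings the slopes to opposite imaginary parts. -/
theorem exists_slopeEquiv_im_eq {z w : ℂ} (hz : 0 < z.im) (hw : w.im < 0) :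
    ∃ z' w' : ℂ, SlopeEquiv z w z' w' ∧ w'.im = -z'.im := by
  by_cases hne : z.im + w.im = 0
  · have h := SlopeEquiv.shift hz hw 0
    simp only [Complex.ofReal_zero, sub_zero] at h
    exact ⟨z, w, h, by linarith⟩
  -- The centre `c` must satisfy `Im z / |z - c|² = -Im w / |w - c|²`, a real quadratic equation
  -- with positive leading factor `-Im z Im w` in its discriminant. Geometrically, `c` is an
  -- endpoint of the hyperbolic perpendicular bisector of `z` and `conj w`.
  have hdisc : discrim (z.im + w.im) (-2 * (z.im * w.re + w.im * z.re))
      (z.im * (w.re ^ 2 + w.im ^ 2) + w.im * (z.re ^ 2 + z.im ^ 2)) =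
      √(4 * (z.im * -w.im) * ((z.re - w.re) ^ 2 + (z.im + w.im) ^ 2)) *
      √(4 * (z.im * -w.im) * ((z.re - w.re) ^ 2 + (z.im + w.im) ^ 2)) := by
    have : 0 < z.im * -w.im := mul_pos hz (neg_pos.2 hw)
    rw [Real.mul_self_sqrt (by positivity), discrim]
    ring
  obtain ⟨c, hc⟩ := exists_quadratic_eq_zero hne ⟨_, hdisc⟩
  have h₁ := SlopeEquiv.shift hz hw c
  have h₂ := SlopeEquiv.invert h₁.im_pos h₁.im_neg one_ne_zero
  refine ⟨_, _, h₁.trans h₂, ?_⟩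
  have hpos : ∀ a : ℂ, a.im ≠ 0 → (a.re - c) ^ 2 + a.im ^ 2 ≠ 0 := fun a ha => by positivity
  have hz' := hpos z hz.ne'
  have hw' := hpos w hw.ne
  simp only [Complex.ofReal_one, one_pow, one_div, Complex.neg_im, Complex.inv_im,
    Complex.normSq_apply, Complex.sub_im, Complex.sub_re, Complex.ofReal_re, Complex.ofReal_im,
    sub_zero, ← pow_two]
  field_simp
  linear_combination hc

/-- Every pair of slopes in opposite half-planes can be brought to `(z, -z)` with `|z| = 1` and
`Re z ≤ 0`. -/
theorem exists_slopeEquiv_neg {z w : ℂ} (hz : 0 < z.im) (hw : w.im < 0) :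
    ∃ z' : ℂ, SlopeEquiv z w z' (-z') ∧ ‖z'‖ = 1 ∧ z'.re ≤ 0 := by
  obtain ⟨z₁, w₁, h₁, him⟩ := exists_slopeEquiv_im_eq hz hw
  have h₂ := h₁.trans (SlopeEquiv.shift h₁.im_pos h₁.im_neg ((z₁.re + w₁.re) / 2))
  have hneg : w₁ - ((z₁.re + w₁.re) / 2 : ℝ) = -(z₁ - ((z₁.re + w₁.re) / 2 : ℝ)) := by
    apply Complex.ext
    · simp only [Complex.sub_re, Complex.neg_re, Complex.ofReal_re]
      ring
    · simpa using him
  rw [hneg] at h₂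
  generalize z₁ - ((z₁.re + w₁.re) / 2 : ℝ) = ζ at h₂
  have normalize : ∀ ζ : ℂ, SlopeEquiv z w ζ (-ζ) → 0 ≤ ζ.re →
      ∃ z' : ℂ, SlopeEquiv z w z' (-z') ∧ ‖z'‖ = 1 ∧ z'.re ≤ 0 := by
    intro ζ h hre
    have hζ : ζ ≠ 0 := by
      rintro rfl
      simpa using h.im_pos
    have hn : 0 < ‖ζ‖ := norm_pos_iff.2 hζ
    -- Inverting with `t² = |ζ|` gives `-|ζ| / ζ`, which has modulus one and real part of sign
    -- opposite to that of `ζ`.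
    have h' := h.trans (SlopeEquiv.invert h.im_pos h.im_neg (Real.sqrt_pos.2 hn).ne')
    rw [← Complex.ofReal_pow, Real.sq_sqrt hn.le, div_neg] at h'
    refine ⟨_, h', by simp [hn.ne'], ?_⟩
    rw [div_eq_mul_inv, Complex.neg_re, Complex.re_ofReal_mul, Complex.inv_re, neg_nonpos]
    have := Complex.normSq_nonneg ζ
    positivity
  rcases le_total 0 ζ.re with hre | hre
  · exact normalize ζ h₂ hre
  · have h₃ := h₂.trans (SlopeEquiv.invert h₂.im_pos h₂.im_neg one_ne_zero)
    rw [div_neg] at h₃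
    refine normalize _ h₃ ?_
    simp only [Complex.ofReal_one, one_pow, one_div, Complex.neg_re, Complex.inv_re]
    rw [← neg_div]
    exact div_nonneg (neg_nonneg.2 hre) (Complex.normSq_nonneg ζ)

/-! ### The rotated oscillator and the angle -/

/-- For slopes `z, -z` the cross term vanishes and the remaining coefficients are `-λ z` and `λ /
z`. -/
theorem weylOfEigen_neg {lam : ℂ} (hlam : lam ≠ 0) (θ : ℝ) :
    weylOfEigen lam (Complex.I * Complex.exp (Complex.I * θ))
      (-(Complex.I * Complex.exp (Complex.I * θ))) =
      (-(Complex.I * lam)) • rotatedOscillator θ := by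
  rw [rotatedOscillator, smul_maximal (by simp [hlam]), weylOfEigen, weyl]
  congr 1
  have hE : Complex.exp (Complex.I * θ) ≠ 0 := Complex.exp_ne_zero _
  have hα : 2 * lam * (Complex.I * Complex.exp (Complex.I * θ)) *
      -(Complex.I * Complex.exp (Complex.I * θ)) / (Complex.I * Complex.exp (Complex.I * θ) -
      -(Complex.I * Complex.exp (Complex.I * θ))) =
      -(Complex.I * lam) * Complex.exp (Complex.I * θ) := by
    field_simp
    ring
  have hγ : 2 * lam / (Complex.I * Complex.exp (Complex.I * θ) -
      -(Complex.I * Complex.exp (Complex.I * θ))) =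
      -(Complex.I * lam) * Complex.exp (-(Complex.I * θ)) := by
    rw [Complex.exp_neg]
    field_simp
    rw [Complex.I_sq]
    norm_num
  rw [hα, hγ, add_neg_cancel, mul_zero, zero_div, mul_zero, zero_smul, sub_zero, smul_add,
    smul_neg, smul_smul, smul_smul]
  abel

/-- With `|z| = 1` the invariant of `(z, -z)` is `|Re z|`. The sign of `Re z` fixes the sine, and
positivity of both `cos θ` and `Im z` fixes the cosine. -/
theorem exists_angle {z : ℂ} (hz : 0 < z.im) (hn : ‖z‖ = 1) {θ : ℝ}
    (hθ : θ ∈ Set.Ico (0 : ℝ) (Real.pi / 2)) (hre : z.re ≤ 0)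
    (hs : Real.sin θ = ‖(z - (starRingEnd ℂ) (-z)) / (z - -z)‖) :
    z = Complex.I * Complex.exp (Complex.I * θ) := by
  have hcos : 0 < Real.cos θ := Real.cos_pos_of_mem_Ioo ⟨by linarith [hθ.1, Real.pi_pos], hθ.2⟩
  have hs' : Real.sin θ = -z.re := by
    rw [hs, map_neg, sub_neg_eq_add, Complex.add_conj, sub_neg_eq_add, ← two_mul, norm_div,
      norm_mul 2 z, hn]
    simp only [mul_one, Complex.norm_ofNat, Complex.norm_real, norm_mul, Real.norm_ofNat,
      Real.norm_eq_abs, abs_of_nonpos hre]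
    ring
  have hc : Real.cos θ = z.im := by
    have h1 := Real.sin_sq_add_cos_sq θ
    have h2 : z.re ^ 2 + z.im ^ 2 = 1 := by
      rw [← one_pow 2, ← hn, ← Complex.normSq_eq_norm_sq, Complex.normSq_apply]
      ring
    rw [hs'] at h1
    exact (sq_eq_sq₀ hcos.le hz.le).1 (by linarith)
  rw [mul_comm Complex.I (θ : ℂ), Complex.exp_mul_I, ← Complex.ofReal_cos, ← Complex.ofReal_sin,
    hs', hc]
  apply Complex.ext <;> simp

/-- It rests on `|z - w|² - |z - conj w|² = -4 Im z Im w > 0`. -/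
theorem invariant_lt_one {z w : ℂ} (hz : 0 < z.im) (hw : w.im < 0) :
    ‖(z - (starRingEnd ℂ) w) / (z - w)‖ < 1 := by
  have hzw : 0 < ‖z - w‖ := norm_pos_iff.2 (sub_ne_zero.2 (ne_of_im hz hw))
  rw [norm_div, div_lt_one hzw, ← sq_lt_sq₀ (norm_nonneg _) hzw.le, ← Complex.normSq_eq_norm_sq,
    ← Complex.normSq_eq_norm_sq, Complex.normSq_apply, Complex.normSq_apply]
  simp only [Complex.sub_re, Complex.sub_im, Complex.conj_re, Complex.conj_im]
  nlinarith [mul_pos hz (neg_pos.2 hw)]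

theorem exists_sin_eq_invariant {z w : ℂ} (hz : 0 < z.im) (hw : w.im < 0) :
    ∃ θ ∈ Set.Ico (0 : ℝ) (Real.pi / 2),
      Real.sin θ = ‖(z - (starRingEnd ℂ) w) / (z - w)‖ := by
  have h := invariant_lt_one hz hw
  have h0 := norm_nonneg ((z - (starRingEnd ℂ) w) / (z - w))
  exact ⟨Real.arcsin _, ⟨Real.arcsin_nonneg.2 h0, Real.arcsin_lt_pi_div_two.2 h⟩,
    Real.sin_arcsin (by linarith) h.le⟩

theorem weylOfEigen_unitarilyEquivalent {lam z w : ℂ} (hlam : lam ≠ 0) (hz : 0 < z.im)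
    (hw : w.im < 0) {θ : ℝ} (hθ : θ ∈ Set.Ico (0 : ℝ) (Real.pi / 2))
    (hs : Real.sin θ = ‖(z - (starRingEnd ℂ) w) / (z - w)‖) :
    UnitarilyEquivalent (weylOfEigen lam z w) ((-(Complex.I * lam)) • rotatedOscillator θ) := by
  obtain ⟨z', h, hn, hre⟩ := exists_slopeEquiv_neg hz hw
  have hz' := exists_angle h.im_pos hn hθ hre (hs.trans h.invariant_eq.symm)
  have h' := h.unitarilyEquivalent lam
  rw [hz', weylOfEigen_neg hlam] at h'
  exact h'

/-! ### Eigensystems and ellipticity -/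

/-- The equations of an eigensystem, in coordinates. -/
theorem IsEigensystem.eqs {α β γ lam aPlus aMinus : ℂ}
    (h : IsEigensystem (fundamentalMatrix α β γ) lam aPlus aMinus) :
    β + γ * aPlus = lam ∧ -α - β * aPlus = lam * aPlus ∧
      β + γ * aMinus = -lam ∧ -α - β * aMinus = -lam * aMinus := by
  have hp : ![1, aPlus] ∈ LinearMap.ker (Matrix.toLin'
      (fundamentalMatrix α β γ - lam • (1 : Matrix (Fin 2) (Fin 2) ℂ))) :=
    h.ker_plus ▸ Submodule.mem_span_singleton_self _
  have hm : ![1, aMinus] ∈ LinearMap.ker (Matrix.toLin'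
      (fundamentalMatrix α β γ + lam • (1 : Matrix (Fin 2) (Fin 2) ℂ))) :=
    h.ker_minus ▸ Submodule.mem_span_singleton_self _
  rw [LinearMap.mem_ker, Matrix.toLin'_apply, funext_iff, Fin.forall_fin_two] at hp hm
  simp [fundamentalMatrix, Matrix.mulVec, dotProduct, Fin.sum_univ_two, Matrix.one_apply] at hp hm
  refine ⟨?_, ?_, ?_, ?_⟩
  · linear_combination hp.1
  · linear_combination hp.2
  · linear_combination hm.1
  · linear_combination hm.2

theorem IsEigensystem.weyl_eq {α β γ lam aPlus aMinus : ℂ}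
    (h : IsEigensystem (fundamentalMatrix α β γ) lam aPlus aMinus) :
    lam ≠ 0 ∧ weyl α β γ = weylOfEigen lam aPlus aMinus := by
  have hne := ne_of_im h.im_plus h.im_minus
  have hsub := sub_ne_zero.2 hne
  obtain ⟨h1, h2, h3, h4⟩ := h.eqs
  constructor
  -- If `λ = 0`, both kernels equal `Ker F`, so `(1, a₊)` and `(1, a₋)` are proportional, hence
  -- equal.
  · rintro rfl
    have hp := h.ker_plus
    have hm := h.ker_minus
    rw [zero_smul, sub_zero] at hp
    rw [zero_smul, add_zero, hp] at hm
    have hmem : ![1, aPlus] ∈ Submodule.span ℂ {![1, aMinus]} :=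
      hm ▸ Submodule.mem_span_singleton_self _
    obtain ⟨c, hc⟩ := Submodule.mem_span_singleton.1 hmem
    have hc0 := congrFun hc 0
    have hc1 := congrFun hc 1
    simp at hc0 hc1
    rw [hc0, one_mul] at hc1
    exact hne hc1.symm
  · have hγ : γ = 2 * lam / (aPlus - aMinus) := by
      rw [eq_div_iff hsub]
      linear_combination h1 - h3
    have hβ : β = -lam * (aPlus + aMinus) / (aPlus - aMinus) := by
      rw [eq_div_iff hsub]
      linear_combination aPlus * h3 - aMinus * h1
    have hα : α = 2 * lam * aPlus * aMinus / (aPlus - aMinus) := by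
      rw [eq_div_iff hsub]
      linear_combination aMinus * h2 - aPlus * h4
    rw [weylOfEigen, ← hα, ← hβ, ← hγ]

/-- The fundamental matrix of a quadratic form with a root in each half-plane. -/
theorem isEigensystem_of_roots {α β γ z w : ℂ} (hγ : γ ≠ 0) (hz : 0 < z.im) (hw : w.im < 0)
    (hβ : 2 * β = -γ * (z + w)) (hα : α = γ * z * w) :
    IsEigensystem (fundamentalMatrix α β γ) (γ * (z - w) / 2) z w := by
  have hβ' : β = -γ * (z + w) / 2 := by linear_combination hβ / 2
  have hker : ∀ lam a : ℂ, β + γ * a = lam → -α - β * a = lam * a →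
      LinearMap.ker (Matrix.toLin' (fundamentalMatrix α β γ -
        lam • (1 : Matrix (Fin 2) (Fin 2) ℂ))) = Submodule.span ℂ {![1, a]} := by
    intro lam a h1 h2
    ext v
    rw [LinearMap.mem_ker, Matrix.toLin'_apply, funext_iff, Fin.forall_fin_two,
      Submodule.mem_span_singleton]
    simp only [fundamentalMatrix, Matrix.mulVec, dotProduct, Fin.sum_univ_two, Matrix.sub_apply,
      Matrix.smul_apply, Matrix.one_apply, Matrix.of_apply, Matrix.cons_val', Matrix.cons_val_zero,
      Matrix.cons_val_one, smul_eq_mul, Pi.zero_apply]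
    simp
    constructor
    · rintro ⟨h3, -⟩
      refine ⟨v 0, ?_⟩
      -- Since `γ ≠ 0`, the first row alone fixes the ratio of the coordinates.
      have : v 1 = v 0 * a := by
        apply mul_left_cancel₀ hγ
        linear_combination h3 - v 0 * h1
      ext i
      fin_cases i <;> simp [this]
    · rintro ⟨c, rfl⟩
      simp
      constructor
      · linear_combination c * h1
      · linear_combination c * h2
  refine ⟨?_, hker _ _ ?_ ?_, ?_, hz, hw⟩
  · ext μ
    rw [spectrum.mem_iff, Matrix.isUnit_iff_isUnit_det, isUnit_iff_ne_zero, not_not,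
      Matrix.det_fin_two, Set.mem_insert_iff, Set.mem_singleton_iff]
    have : (μ - γ * (z - w) / 2) * (μ + γ * (z - w) / 2) = 0 ↔
        μ = γ * (z - w) / 2 ∨ μ = -(γ * (z - w) / 2) := by
      rw [mul_eq_zero, sub_eq_zero, add_eq_zero_iff_eq_neg]
    rw [← this]
    refine iff_of_eq (congrArg (· = 0) ?_)
    simp [fundamentalMatrix, Matrix.algebraMap_matrix_apply]
    rw [hα, hβ']
    ring
  · rw [hβ']; ring
  · rw [hα, hβ']; ring
  · have := hker (-(γ * (z - w) / 2)) w (by rw [hβ']; ring) (by rw [hα, hβ']; ring)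
    rwa [neg_smul, sub_neg_eq_add] at this

/-- As `t` runs over the real line, `t - z` stays in the lower half-plane, so its argument varies
continuously, with limits `-π` at `-∞` and `0` at `+∞`. The intermediate value theorem applies to
the sum. -/
theorem exists_arg_add_arg {z w : ℂ} (hz : 0 < z.im) (hw : 0 < w.im) {φ : ℝ}
    (hφ : φ ∈ Set.Ioo (-(2 * Real.pi)) 0) :
    ∃ t : ℝ, Complex.arg (t - z) + Complex.arg (t - w) = φ := by
  have hcont : ∀ a : ℂ, 0 < a.im → Continuous fun t : ℝ => Complex.arg (t - a) := by
    intro a ha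
    refine continuous_iff_continuousAt.2 fun t => ?_
    have h := Complex.continuousAt_arg (x := (t : ℂ) - a) (Or.inr (by simp [ha.ne']))
    exact h.comp (f := fun t : ℝ => (t : ℂ) - a) (by fun_prop)
  have htop : ∀ a : ℂ, 0 < a.im →
      Filter.Tendsto (fun t : ℝ => Complex.arg (t - a)) Filter.atTop (nhds 0) := by
    intro a _
    have hlim : Filter.Tendsto (fun t : ℝ => 1 - a * (t⁻¹ : ℝ)) Filter.atTop (nhds 1) := by
      have h := (Complex.continuous_ofReal.tendsto 0).comp tendsto_inv_atTop_zero
      simpa using (h.const_mul a).const_sub 1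
    have h := (Complex.continuousAt_arg Complex.one_mem_slitPlane).tendsto.comp hlim
    rw [Complex.arg_one] at h
    refine h.congr' ?_
    filter_upwards [Filter.eventually_gt_atTop 0] with t ht
    have ht' : (t : ℂ) ≠ 0 := by exact_mod_cast ht.ne'
    rw [Function.comp_apply, ← Complex.arg_real_mul _ ht]
    congr 1
    push_cast
    field_simp
  have hbot : ∀ a : ℂ, 0 < a.im →
      Filter.Tendsto (fun t : ℝ => Complex.arg (t - a)) Filter.atBot (nhds (-Real.pi)) := by
    intro a ha
    have hlim : Filter.Tendsto (fun t : ℝ => -1 + a * (t⁻¹ : ℝ)) Filter.atBot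
        (nhdsWithin (-1) {z | z.im < 0}) := by
      refine tendsto_nhdsWithin_iff.2 ⟨?_, ?_⟩
      · have h := (Complex.continuous_ofReal.tendsto 0).comp tendsto_inv_atBot_zero
        simpa using (h.const_mul a).const_add (-1)
      · filter_upwards [Filter.eventually_lt_atBot 0] with t ht
        rw [Complex.add_im, Complex.im_mul_ofReal]
        simpa using mul_neg_of_pos_of_neg ha (inv_lt_zero.2 ht)
    have h := (Complex.tendsto_arg_nhdsWithin_im_neg_of_re_neg_of_im_zero (z := -1)
      (by simp) (by simp)).comp hlim
    refine h.congr' ?_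
    filter_upwards [Filter.eventually_lt_atBot 0] with t ht
    have ht' : (t : ℂ) ≠ 0 := by exact_mod_cast ht.ne
    rw [Function.comp_apply, ← Complex.arg_real_mul _ (neg_pos.2 ht)]
    congr 1
    push_cast
    field_simp
    ring
  have h1 := (htop z hz).add (htop w hw)
  have h2 := (hbot z hz).add (hbot w hw)
  have h3 := h1.eventually (lt_mem_nhds (a := φ) (by simpa using hφ.2))
  have h4 := h2.eventually (eventually_lt_nhds (by linarith [hφ.1] : -Real.pi + -Real.pi < φ))
  obtain ⟨t₁, ht₁⟩ := h3.exists
  obtain ⟨t₂, ht₂⟩ := h4.exists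
  exact mem_range_of_exists_le_of_exists_ge ((hcont z hz).add (hcont w hw)) ⟨t₂, ht₂.le⟩
    ⟨t₁, ht₁.le⟩

theorem symbol_eq_of_roots {α β γ z w : ℂ} (hβ : 2 * β = -γ * (z + w)) (hα : α = γ * z * w)
    (p : ℝ × ℝ) : symbol α β γ p = γ * ((p.2 - z * p.1) * (p.2 - w * p.1)) := by
  rw [symbol, hβ, hα]
  ring

/-- A quadratic form with both roots in the upper half-plane takes every complex value. -/
theorem range_symbol_of_im_pos {α β γ z w : ℂ} (hγ : γ ≠ 0) (hz : 0 < z.im) (hw : 0 < w.im)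
    (hβ : 2 * β = -γ * (z + w)) (hα : α = γ * z * w) :
    Set.range (symbol α β γ) = Set.univ := by
  refine Set.eq_univ_of_forall fun v => ?_
  suffices h : ∃ p : ℝ × ℝ, (p.2 - z * p.1) * (p.2 - w * p.1) = v / γ by
    obtain ⟨p, hp⟩ := h
    exact ⟨p, by rw [symbol_eq_of_roots hβ hα, hp, mul_div_cancel₀ _ hγ]⟩
  generalize v / γ = v
  -- The direction of argument `0` is excluded from the open interval of sums of arguments; it is
  -- attained on the axis `x = 0`.
  by_cases hv : v.arg = 0
  · refine ⟨(0, √‖v‖), ?_⟩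
    have h := Complex.norm_mul_exp_arg_mul_I v
    rw [hv, Complex.ofReal_zero, zero_mul, Complex.exp_zero, mul_one] at h
    rw [Complex.ofReal_zero, mul_zero, mul_zero, sub_zero, ← Complex.ofReal_mul,
      Real.mul_self_sqrt (norm_nonneg v), h]
  obtain ⟨φ, hφ, hexp⟩ : ∃ φ ∈ Set.Ioo (-(2 * Real.pi)) 0,
      Complex.exp (φ * Complex.I) = Complex.exp (v.arg * Complex.I) := by
    have h1 := Complex.neg_pi_lt_arg v
    have h2 := Complex.arg_le_pi v
    have h3 := Real.pi_pos
    rcases lt_or_gt_of_ne hv with h | h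
    · exact ⟨v.arg, ⟨by linarith, h⟩, rfl⟩
    · refine ⟨v.arg - 2 * Real.pi, ⟨by linarith, by linarith⟩, ?_⟩
      push_cast
      rw [sub_mul, Complex.exp_sub, Complex.exp_two_pi_mul_I, div_one]
  obtain ⟨t, ht⟩ := exists_arg_add_arg hz hw hφ
  have hne : ∀ a : ℂ, 0 < a.im → (t : ℂ) - a ≠ 0 := fun a ha h => by
    have := congrArg Complex.im h
    simp [ha.ne'] at this
  have hr : 0 < ‖(t : ℂ) - z‖ * ‖(t : ℂ) - w‖ :=
    mul_pos (norm_pos_iff.2 (hne z hz)) (norm_pos_iff.2 (hne w hw))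
  have hprod : ((t : ℂ) - z) * (t - w) =
      (‖(t : ℂ) - z‖ * ‖(t : ℂ) - w‖ : ℝ) * Complex.exp (v.arg * Complex.I) := by
    rw [← hexp, ← ht]
    conv_lhs => rw [← Complex.norm_mul_exp_arg_mul_I ((t : ℂ) - z),
      ← Complex.norm_mul_exp_arg_mul_I ((t : ℂ) - w)]
    push_cast
    rw [add_mul, Complex.exp_add]
    ring
  generalize ‖(t : ℂ) - z‖ * ‖(t : ℂ) - w‖ = r at hr hprod
  have hx : ((√(‖v‖ / r) : ℝ) : ℂ) ^ 2 * r = ‖v‖ := by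
    rw [← Complex.ofReal_pow, Real.sq_sqrt (by positivity), ← Complex.ofReal_mul,
      div_mul_cancel₀ _ hr.ne']
  -- On the line `ξ = t x` the form is `x² (t - z)(t - w)`: `t` sets the argument and `x² = |v| / r`
  -- the modulus.
  refine ⟨(√(‖v‖ / r), t * √(‖v‖ / r)), ?_⟩
  rw [Complex.ofReal_mul]
  linear_combination ((√(‖v‖ / r) : ℝ) : ℂ) ^ 2 * hprod +
    Complex.exp (v.arg * Complex.I) * hx + Complex.norm_mul_exp_arg_mul_I v

theorem conj_symbol (α β γ : ℂ) (p : ℝ × ℝ) :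
    symbol ((starRingEnd ℂ) α) ((starRingEnd ℂ) β) ((starRingEnd ℂ) γ) p =
      (starRingEnd ℂ) (symbol α β γ p) := by
  simp only [symbol, map_add, map_mul, map_pow, map_ofNat, Complex.conj_ofReal]

/-- A quadratic form with both roots in the lower half-plane takes every complex value. -/
theorem range_symbol_of_im_neg {α β γ z w : ℂ} (hγ : γ ≠ 0) (hz : z.im < 0) (hw : w.im < 0)
    (hβ : 2 * β = -γ * (z + w)) (hα : α = γ * z * w) :
    Set.range (symbol α β γ) = Set.univ := by
  have h := range_symbol_of_im_pos (α := (starRingEnd ℂ) α) (β := (starRingEnd ℂ) β)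
    (γ := (starRingEnd ℂ) γ) (z := (starRingEnd ℂ) z) (w := (starRingEnd ℂ) w)
    (by simpa) (by simpa) (by simpa)
    (by simpa only [map_mul, map_neg, map_add, map_ofNat] using congrArg (starRingEnd ℂ) hβ)
    (by rw [hα, map_mul, map_mul])
  refine Set.eq_univ_of_forall fun v => ?_
  obtain ⟨p, hp⟩ : (starRingEnd ℂ) v ∈ Set.range _ := h ▸ Set.mem_univ _
  rw [conj_symbol] at hp
  exact ⟨p, (starRingEnd ℂ).injective hp⟩

theorem IsElliptic.exists_isEigensystem {α β γ : ℂ} (hq : IsElliptic (symbol α β γ)) :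
    ∃ lam aPlus aMinus : ℂ, IsEigensystem (fundamentalMatrix α β γ) lam aPlus aMinus := by
  obtain ⟨hzero, hrange⟩ := hq
  have hγ : γ ≠ 0 := by
    rintro rfl
    simpa using hzero (0, 1) (by simp [symbol])
  obtain ⟨s, hs⟩ := IsAlgClosed.exists_pow_nat_eq (β ^ 2 - α * γ) two_pos
  have hα : α = γ * ((-β + s) / γ) * ((-β - s) / γ) := by
    field_simp
    linear_combination hs
  have hβ : 2 * β = -γ * ((-β + s) / γ + (-β - s) / γ) := by
    field_simp
    ring
  generalize (-β + s) / γ = z at hα hβ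
  generalize (-β - s) / γ = w at hα hβ
  have hreal : ∀ a : ℂ, a = z ∨ a = w → a.im ≠ 0 := by
    intro a ha him
    have ha' : ((a.re : ℝ) : ℂ) = a := Complex.ext rfl (by simp [him])
    have h := hzero (1, a.re) (by
      rw [symbol_eq_of_roots hβ hα]
      rcases ha with rfl | rfl <;> simp [ha'])
    simp at h
  rcases lt_or_gt_of_ne (hreal z (Or.inl rfl)) with hz | hz <;>
    rcases lt_or_gt_of_ne (hreal w (Or.inr rfl)) with hw | hw
  · exact absurd (range_symbol_of_im_neg hγ hz hw hβ hα) hrange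
  · exact ⟨_, _, _, isEigensystem_of_roots hγ hw hz (by rw [hβ]; ring) (by rw [hα]; ring)⟩
  · exact ⟨_, _, _, isEigensystem_of_roots hγ hz hw hβ hα⟩
  · exact absurd (range_symbol_of_im_pos hγ hz hw hβ hα) hrange

end QuadraticOperator

theorem mainTheorem2 (α β γ : ℂ)
    (hq : QuadraticOperator.IsElliptic (QuadraticOperator.symbol α β γ)) :
    (∃ lam aPlus aMinus : ℂ, QuadraticOperator.IsEigensystem
      (QuadraticOperator.fundamentalMatrix α β γ) lam aPlus aMinus) ∧
    ∀ lam aPlus aMinus : ℂ, QuadraticOperator.IsEigensystem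
      (QuadraticOperator.fundamentalMatrix α β γ) lam aPlus aMinus →
      (∃ θ ∈ Set.Ico (0 : ℝ) (Real.pi / 2),
        Real.sin θ = ‖(aPlus - (starRingEnd ℂ) aMinus) / (aPlus - aMinus)‖) ∧
      ∀ θ ∈ Set.Ico (0 : ℝ) (Real.pi / 2),
        Real.sin θ = ‖(aPlus - (starRingEnd ℂ) aMinus) / (aPlus - aMinus)‖ →
        QuadraticOperator.UnitarilyEquivalent (QuadraticOperator.weyl α β γ)
          ((-(Complex.I * lam)) • QuadraticOperator.rotatedOscillator θ) := by
  refine ⟨hq.exists_isEigensystem, fun lam aPlus aMinus h =>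
    ⟨QuadraticOperator.exists_sin_eq_invariant h.im_plus h.im_minus, fun θ hθ hs => ?_⟩⟩
  obtain ⟨hlam, heq⟩ := h.weyl_eq
  rw [heq]
  exact QuadraticOperator.weylOfEigen_unitarilyEquivalent hlam h.im_plus h.im_minus hθ hs
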